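/- Channel. Let $\zeta,\sigma_z^2,P_T>0$ and let $p_{ch}=\mathbb{Q}\big(\sqrt{\zeta P_T/\sigma_z^2}\big)$ with $\mathbb{Q}(x)=\int_x^\infty \frac{1}{\sqrt{2\pi}}e^{-t^2/2}\,dt$, the raw bit-error probability of BPSK with transmit power $P_T$ over an AWGN channel with path loss $\zeta$ and noise variance $\sigma_z^2$, after hard decisions at the receiver. A message $b$ of $k$ fair coin flips is encoded by a map $\{0,1\}^k\to\{0,1\}^n$, the codeword is sent over the resulting memoryless binary symmetric channel BSC$(p_{ch})$, and a decoder computes an estimate $\hat b$ of $b$ from the $n$ received bits. The block-error probability is $P_e^{blk}=\Pr(\hat b\neq b)$. Implementation Model $(\lambda,\mu)$, with $\lambda,\mu>0$. A circuit consists of a square $[0,l]^2\subset\mathbb{R}^2$, $l>0$, and a set of nodes contained in $[0,l]^2\cap\lambda\mathbb{Z}^2$. Each of the $n$ input bits is stored in its own (input) node and each of the $k$ output bits is produced at its own (output) node. In a fixed-message-length computation, finitely many binary-string messages are sent noiselessly, in a predetermined order, along predetermined links (ordered pairs of distinct nodes), with predetermined lengths that do not depend on the input. Each message is a function of the messages that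 its transmitting node has received so far and, if that node is an input node, of the input bit stored there; each output bit is a function of the messages that its node has received by the end and, if that node is also an input node, of the input bit stored there. The bit-meters of a link are the total number of bits sent on it times the Euclidean distance between its ends, and the bit-meters of the computation are the sum over all links. (The energy spent is $\mu$ times the bit-meters.) Theorem. If the decoder is a circuit in Implementation Model $(\lambda,\mu)$ that performs a fixed-message-length computation and has block-error probability $P_e^{blk}$, and if $$\log\frac{1}{10\,P_e^{blk}}>50\,\log\frac{1}{2p_{ch}},$$ then $$\text{bit-meters}(\mathrm{DecCkt})\;\ge\;\frac{k}{48\sqrt2}\,\sqrt{\frac{\log\frac{1}{10\,P_e^{blk}}}{\log\frac{1}{2p_{ch}}}}\;\lambda .$$ -/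

import Mathlib

namespace InfoFriction

/-! ## Channel -/

/-- The Gaussian tail function `Q(x) = ∫_x^∞ (1/√(2π)) exp(-t²/2) dt`. -/
noncomputable def gaussianQ (x : ℝ) : ℝ :=
  ∫ t in Set.Ioi x, 1 / Real.sqrt (2 * Real.pi) * Real.exp (-t ^ 2 / 2)

/-- Parameters of the hard-decision BPSK/AWGN channel: path loss `ζ` and noise variance `σ_z²`. -/
structure ChannelModel where
  /-- path loss -/
  zeta : ℝ
  /-- noise variance -/
  sigmaSq : ℝ
  zeta_pos : 0 < zeta
  sigmaSq_pos : 0 < sigmaSq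

/-- Raw bit-error probability `p_ch = Q(√(ζ P_T / σ_z²))` at transmit power `P_T`. -/
noncomputable def ChannelModel.pch (H : ChannelModel) (PT : ℝ) : ℝ :=
  gaussianQ (Real.sqrt (H.zeta * PT / H.sigmaSq))

/-- Binary strings of length `m`. -/
abbrev Bits (m : ℕ) : Type := Fin m → Bool

/-- Probability that `n` uses of a memoryless binary symmetric channel with crossover probability
`p` turn the word `x` into the word `y`. -/
noncomputable def bscProb (p : ℝ) {n : ℕ} (x y : Bits n) : ℝ :=
  ∏ i, if y i = x i then 1 - p else p

/-- Block-error probability `Pr(b̂ ≠ b)`: the message `b` consists of `k` fair coin flips, the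
codeword `enc b` is sent over the binary symmetric channel with crossover probability `p`, and
`b̂ = dec y` for the received word `y`. -/
noncomputable def blockErrorProb (p : ℝ) {n k : ℕ} (enc : Bits k → Bits n)
    (dec : Bits n → Bits k) : ℝ :=
  ∑ b : Bits k, (1 / 2 : ℝ) ^ k * ∑ y : Bits n, if dec y ≠ b then bscProb p (enc b) y else 0

/-! ## Circuits -/

/-- The Euclidean plane. -/
abbrev Plane : Type := EuclideanSpace ℝ (Fin 2)

/-- The substrate `Sq(l)`: the square with vertices `(0,0)`, `(0,l)`, `(l,0)`, `(l,l)`. -/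
def Substrate (l : ℝ) : Set Plane := {p | ∀ i, p i ∈ Set.Icc 0 l}

/-- The square lattice of the points `(s λ, t λ)` with `s, t ∈ ℤ`. -/
def SquareLattice (lam : ℝ) : Set Plane := {p | ∃ s t : ℤ, p = !₂[s * lam, t * lam]}

/-- The lattice points that lie in the substrate `Sq(l)`. -/
def Grid (lam l : ℝ) : Set Plane := SquareLattice lam ∩ Substrate l

/-- Implementation Model `(λ, μ)`: minimum distance `λ` between computational nodes, and
coefficient of information-friction `μ` (the energy spent per bit-meter). -/
structure ImplementationModel where
  /-- minimum distance between nodes -/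
  lam : ℝ
  /-- coefficient of information-friction -/
  mu : ℝ
  lam_pos : 0 < lam
  mu_pos : 0 < mu

/-- A circuit: a substrate together with a collection of grid points, the computational nodes.
(The grid is a finite set, so the collection is a `Finset`.) -/
structure Circuit (M : ImplementationModel) where
  /-- side of the substrate -/
  side : ℝ
  side_pos : 0 < side
  /-- the computational nodes -/
  nodes : Finset Plane
  nodes_subset : (nodes : Set Plane) ⊆ Grid M.lam side

variable {M : ImplementationModel}

/-- The computational nodes of a circuit. -/
abbrev Circuit.Node (C : Circuit M) : Type := {v : Plane // v ∈ C.nodes}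

/-- The unidirectional links: ordered pairs of distinct nodes. -/
abbrev Circuit.Link (C : Circuit M) : Type := {e : C.Node × C.Node // e.1 ≠ e.2}

noncomputable instance (C : Circuit M) : Fintype C.Link := Fintype.ofFinite _

/-- The transmitting node of a link. -/
def Circuit.src (C : Circuit M) (e : C.Link) : C.Node := e.1.1

/-- The receiving node of a link. -/
def Circuit.dst (C : Circuit M) (e : C.Link) : C.Node := e.1.2

/-! ## Fixed-message-length computations -/

/-- A fixed-message-length computation with `n` input bits and `k` output bits on the circuit `C`.
Input and output nodes hold one bit each; all other nodes are helper nodes. The sequence of the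
links used and the length of every message are predetermined. Each message is a function of the
messages that its transmitting node has received so far and, if that node is an input node, of the
input bit stored there. Each output bit is a function of what its node has received by the end,
and of the input bit stored there, if any. -/
structure FixedLengthComputation (C : Circuit M) (n k : ℕ) where
  /-- the node that stores the `i`-th input bit -/
  inputNode : Fin n ↪ C.Node
  /-- the node that stores the `j`-th output bit -/
  outputNode : Fin k ↪ C.Node
  /-- number of messages -/
  numMessages : ℕ
  /-- the link that carries message `t` -/
  link : Fin numMessages → C.Link
  /-- number of bits of message `t` -/
  size : Fin numMessages → ℕ
  /-- the rule for message `t`: messages received at its source before, and stored input bit -/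
  message : (t : Fin numMessages) →
    ((s : Fin numMessages) → s < t → C.dst (link s) = C.src (link t) → Bits (size s)) →
    ((i : Fin n) → inputNode i = C.src (link t) → Bool) → Bits (size t)
  /-- the rule for output bit `j`: all messages received at its node, and stored input bit -/
  output : (j : Fin k) →
    ((s : Fin numMessages) → C.dst (link s) = outputNode j → Bits (size s)) →
    ((i : Fin n) → inputNode i = outputNode j → Bool) → Bool

namespace FixedLengthComputation

variable {C : Circuit M} {n k : ℕ}

/-- The content of message `t` when the computation is run on input `x`. -/
def sent (D : FixedLengthComputation C n k) (x : Bits n) (t : Fin D.numMessages) :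
    Bits (D.size t) :=
  D.message t (fun s _ _ => D.sent x s) (fun i _ => x i)
termination_by t

/-- The output of the computation on input `x`. -/
def run (D : FixedLengthComputation C n k) (x : Bits n) : Bits k :=
  fun j => D.output j (fun s _ => D.sent x s) (fun i _ => x i)

open Classical in
/-- Total number of bits carried by the messages on the link `e`. -/
noncomputable def linkBits (D : FixedLengthComputation C n k) (e : C.Link) : ℕ :=
  ∑ t with D.link t = e, D.size t

/-- Bit-meters of a link: the bits it carries times the Euclidean distance of its two ends. -/
noncomputable def linkBitMeters (D : FixedLengthComputation C n k) (e : C.Link) : ℝ :=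
  D.linkBits e * dist (C.src e : Plane) (C.dst e : Plane)

/-- Bit-meters of the circuit: the sum over all links. -/
noncomputable def bitMeters (D : FixedLengthComputation C n k) : ℝ :=
  ∑ e : C.Link, D.linkBitMeters e

end FixedLengthComputation

end InfoFriction

namespace InfoFriction

/-! The proof is a cut-set argument averaged over many nested boxes. Flipping a bit with probability
`p ≤ 1/2` is the same as replacing it, with probability `2 * p`, by a fair coin flip. Hence all
inputs inside a node set `S` are erased with probability `(2 * p) ^ m`, where `m` is their number.
If fewer bits enter `S` than `S` has outputs, the decoder then errs with probability at least 1/2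
(`half_mul_pow_le_blockErrorProb`). A box of side `4 * q` lattice steps holds at most `(4 * q) ^ 2`
inputs, so for a small enough block error every such box, and every box nested in it, must receive
at least as many bits as it has outputs.

Tile the lattice by these boxes and shrink each one concentrically by `0, …, q - 1` steps. A link
crosses inwards at most as many of the boxes as its length in units of `λ`, so bit-meters pay for
all the cuts at once (`sum_card_le_bitMeters`). An output in the middle half of its tile lies in all
`q` nested boxes, and each output is in the middle for one of four shifts of the tiling. Summing
over the shifts gives `k * q * λ ≤ 4 * bitMeters`, with `q` of order `√R`, where `R` is the ratio of
logarithms. -/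

open MeasureTheory in
lemma integrable_gaussian_density :
    Integrable (fun t : ℝ => 1 / Real.sqrt (2 * Real.pi) * Real.exp (-t ^ 2 / 2)) := by
  have h := (integrable_exp_neg_mul_sq (b := 1 / 2) (by norm_num)).const_mul
    (1 / Real.sqrt (2 * Real.pi))
  refine h.congr (Filter.Eventually.of_forall fun t => ?_)
  simp only
  congr 2
  ring

open MeasureTheory in
lemma setIntegral_gaussian_density_pos {s : Set ℝ} (hs : volume s ≠ 0) :
    0 < ∫ t in s, 1 / Real.sqrt (2 * Real.pi) * Real.exp (-t ^ 2 / 2) := by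
  have hpos : ∀ t : ℝ, 0 < 1 / Real.sqrt (2 * Real.pi) * Real.exp (-t ^ 2 / 2) := fun t => by
    positivity
  rw [integral_pos_iff_support_of_nonneg (fun t => (hpos t).le)
    integrable_gaussian_density.integrableOn]
  have hsupp : Function.support
      (fun t : ℝ => 1 / Real.sqrt (2 * Real.pi) * Real.exp (-t ^ 2 / 2)) = Set.univ :=
    Set.eq_univ_of_forall fun t => (hpos t).ne'
  rw [hsupp, Measure.restrict_apply_univ]
  exact pos_iff_ne_zero.mpr hs

lemma gaussianQ_pos (x : ℝ) : 0 < gaussianQ x :=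
  setIntegral_gaussian_density_pos (by simp)

lemma gaussianQ_zero : gaussianQ 0 = 1 / 2 := by
  have h := integral_gaussian_Ioi (1 / 2)
  have h2 : Real.sqrt (Real.pi / (1 / 2)) = Real.sqrt (2 * Real.pi) := by
    congr 1; ring
  unfold gaussianQ
  rw [MeasureTheory.integral_const_mul]
  have h3 : ∀ t : ℝ, Real.exp (-t ^ 2 / 2) = Real.exp (-(1 / 2) * t ^ 2) := fun t => by
    congr 1; ring
  simp_rw [h3]
  rw [h, h2]
  have : 0 < Real.sqrt (2 * Real.pi) := by positivity
  field_simp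

lemma gaussianQ_lt_half {x : ℝ} (hx : 0 < x) : gaussianQ x < 1 / 2 := by
  rw [← gaussianQ_zero]
  unfold gaussianQ
  rw [← Set.Ioc_union_Ioi_eq_Ioi hx.le, MeasureTheory.setIntegral_union
    (Set.Ioc_disjoint_Ioi le_rfl) measurableSet_Ioi
    integrable_gaussian_density.integrableOn integrable_gaussian_density.integrableOn]
  have := setIntegral_gaussian_density_pos (s := Set.Ioc 0 x) (by simpa using hx)
  linarith

lemma ChannelModel.pch_pos (H : ChannelModel) (PT : ℝ) : 0 < H.pch PT := gaussianQ_pos _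

lemma ChannelModel.pch_lt_half (H : ChannelModel) {PT : ℝ} (hPT : 0 < PT) :
    H.pch PT < 1 / 2 := by
  have := H.zeta_pos
  have := H.sigmaSq_pos
  exact gaussianQ_lt_half (by positivity)

/-! ### Errors and erasures on the channel. -/

lemma blockErrorProb_nonneg {p : ℝ} (hp : 0 ≤ p) (hp1 : p ≤ 1) {n k : ℕ}
    (enc : Bits k → Bits n) (dec : Bits n → Bits k) : 0 ≤ blockErrorProb p enc dec := by
  unfold blockErrorProb bscProb
  refine Finset.sum_nonneg fun b _ => mul_nonneg (by positivity) (Finset.sum_nonneg fun y _ => ?_)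
  split_ifs
  · refine Finset.prod_nonneg fun i _ => ?_
    split_ifs <;> linarith
  · exact le_rfl

/-- A channel use with crossover probability `p ≤ 1/2` acts as an erasure with probability `2p`:
restricting to the coordinates outside `I` costs a factor `p` per coordinate of `I`. -/
lemma pow_mul_sum_le_sum_bscProb {p : ℝ} (hp : 0 ≤ p) (hp2 : p ≤ 1 / 2) {n : ℕ} (I : Finset (Fin n))
    (x : Bits n) (g : Bits n → Prop) [DecidablePred g] (h : ({i // i ∈ I} → Bool) → Prop)
    [DecidablePred h] (hgh : ∀ y, h (fun i => y i) → g y) :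
    p ^ I.card * (∑ z : {i // i ∈ I} → Bool, if h z then 1 else 0) ≤
      ∑ y : Bits n, if g y then bscProb p x y else 0 := by
  have hone : ∑ w : {i // i ∉ I} → Bool, ∏ i, (if w i = x i then 1 - p else p) = 1 := by
    rw [← Fintype.prod_sum (fun (i : {i // i ∉ I}) (c : Bool) => if c = x i then 1 - p else p)]
    refine Finset.prod_eq_one fun i _ => ?_
    cases x i <;> simp
  have hW : ∀ w : {i // i ∉ I} → Bool, 0 ≤ ∏ i, (if w i = x i then 1 - p else p) := fun w =>
    Finset.prod_nonneg fun i _ => by split_ifs <;> linarith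
  rw [← Equiv.sum_comp (Equiv.piEquivPiSubtypeProd (· ∈ I) (fun _ => Bool)).symm,
    Fintype.sum_prod_type, Finset.mul_sum]
  refine Finset.sum_le_sum fun z _ => ?_
  by_cases hz : h z
  · rw [if_pos hz, ← hone, Finset.mul_sum]
    refine Finset.sum_le_sum fun w _ => ?_
    have hg : g ((Equiv.piEquivPiSubtypeProd (· ∈ I) (fun _ => Bool)).symm (z, w)) := by
      apply hgh
      convert hz with i
      simp
    rw [if_pos hg, bscProb, ← Fintype.prod_subtype_mul_prod_subtype (· ∈ I)]
    have h1 : p ^ I.card ≤ ∏ i : {i // i ∈ I},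
        (if (Equiv.piEquivPiSubtypeProd (· ∈ I) (fun _ => Bool)).symm (z, w) i = x i
          then 1 - p else p) := by
      have hc : p ^ I.card = ∏ _i : {i // i ∈ I}, p := by simp
      rw [hc]
      refine Finset.prod_le_prod (fun _ _ => hp) fun i _ => ?_
      split_ifs <;> linarith
    have h2 : ∏ i : {i // i ∉ I},
        (if (Equiv.piEquivPiSubtypeProd (· ∈ I) (fun _ => Bool)).symm (z, w) i = x i
          then 1 - p else p) = ∏ i, (if w i = x i then 1 - p else p) := by
      refine Finset.prod_congr rfl fun i _ => ?_
      simp [i.2]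
    rw [h2]
    convert mul_le_mul_of_nonneg_right h1 (hW w)
  · rw [if_neg hz, mul_zero]
    refine Finset.sum_nonneg fun w _ => ?_
    split_ifs
    · exact Finset.prod_nonneg fun i _ => by split_ifs <;> linarith
    · exact le_rfl

/-! ### Cut-set bounds for computations. -/

namespace FixedLengthComputation

variable {M : ImplementationModel} {C : Circuit M} {n k : ℕ}

/-- The message `t` enters the set `S` of nodes. -/
def Enters (D : FixedLengthComputation C n k) (S : C.Node → Prop) (t : Fin D.numMessages) : Prop :=
  ¬ S (C.src (D.link t)) ∧ S (C.dst (D.link t))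

/-- Induction on time: a message sent from inside `S` depends only on inputs in `S` and on earlier
messages received in `S`. -/
lemma sent_eq_of_entering_eq (D : FixedLengthComputation C n k) (S : C.Node → Prop)
    {x x' : Bits n} (hx : ∀ i, S (D.inputNode i) → x i = x' i)
    (hE : ∀ t, D.Enters S t → D.sent x t = D.sent x' t) (t : Fin D.numMessages)
    (ht : S (C.src (D.link t)) ∨ S (C.dst (D.link t))) : D.sent x t = D.sent x' t := by
  induction t using WellFoundedLT.induction with
  | ind t ih =>
    by_cases hs : S (C.src (D.link t))
    · rw [sent, sent]
      congr 1
      · funext s hst hl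
        exact ih s hst (Or.inr (hl ▸ hs))
      · funext i hi
        exact hx i (hi ▸ hs)
    · exact hE t ⟨hs, ht.resolve_left hs⟩

lemma run_eq_of_entering_eq (D : FixedLengthComputation C n k) (S : C.Node → Prop)
    {x x' : Bits n} (hx : ∀ i, S (D.inputNode i) → x i = x' i)
    (hE : ∀ t, D.Enters S t → D.sent x t = D.sent x' t) {j : Fin k} (hj : S (D.outputNode j)) :
    D.run x j = D.run x' j := by
  unfold run
  congr 1
  · funext s hs
    exact D.sent_eq_of_entering_eq S hx hE s (Or.inr (hs ▸ hj))
  · funext i hi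
    exact hx i (hi ▸ hj)

open Classical in
/-- With the inputs inside `S` fixed, the outputs inside `S` take at most as many values as the
messages that enter `S`. -/
lemma card_reachable_mul_le (D : FixedLengthComputation C n k) (S : C.Node → Prop)
    (I : Finset (Fin n)) (hI : ∀ i, i ∈ I ↔ S (D.inputNode i)) (z : {i // i ∈ I} → Bool) :
    (Finset.univ.filter fun b : Bits k => ∃ x : Bits n, (fun i : {i // i ∈ I} => x i) = z ∧
        ∀ j, S (D.outputNode j) → D.run x j = b j).card *
      2 ^ (Finset.univ.filter fun j => S (D.outputNode j)).card ≤
    2 ^ (∑ t with D.Enters S t, D.size t) * 2 ^ k := by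
  set G := Finset.univ.filter fun b : Bits k => ∃ x : Bits n, (fun i : {i // i ∈ I} => x i) = z ∧
        ∀ j, S (D.outputNode j) → D.run x j = b j with hG
  have hmem : ∀ b : {b // b ∈ G}, ∃ x : Bits n, (fun i : {i // i ∈ I} => x i) = z ∧
        ∀ j, S (D.outputNode j) → D.run x j = b.1 j := fun b =>
    (Finset.mem_filter.1 b.2).2
  choose X hXz hXr using hmem
  -- The entering messages of a witness input determine `b` on the outputs in `S`; the other
  -- coordinates of `b` are recorded directly.
  let F : {b // b ∈ G} → (∀ t : {t // D.Enters S t}, Bits (D.size t)) ×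
      ({j // ¬ S (D.outputNode j)} → Bool) :=
    fun b => (fun t => D.sent (X b) t, fun j => b.1 j)
  have hF : Function.Injective F := by
    intro b b' hbb
    apply Subtype.ext
    funext j
    by_cases hj : S (D.outputNode j)
    · rw [← hXr b j hj, ← hXr b' j hj]
      refine D.run_eq_of_entering_eq S (fun i hi => ?_) (fun t ht => ?_) hj
      · exact congrFun ((hXz b).trans (hXz b').symm) ⟨i, (hI i).2 hi⟩
      · exact congrFun (congrArg Prod.fst hbb) ⟨t, ht⟩
    · exact congrFun (congrArg Prod.snd hbb) ⟨j, hj⟩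
  have hcard := Fintype.card_le_of_injective F hF
  have hT : Fintype.card (∀ t : {t // D.Enters S t}, Bits (D.size t)) =
      2 ^ (∑ t with D.Enters S t, D.size t) := by
    simp only [Fintype.card_pi, Finset.prod_const, Finset.card_univ, Fintype.card_bool,
      Fintype.card_fin, Finset.prod_pow_eq_pow_sum]
    congr 1
    exact (Finset.sum_subtype _ (by simp) _).symm
  have hK : Fintype.card {j // ¬ S (D.outputNode j)} +
      (Finset.univ.filter fun j => S (D.outputNode j)).card = k := by
    rw [Fintype.card_subtype, add_comm, Finset.card_filter_add_card_filter_not]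
    simp
  rw [Fintype.card_coe, Fintype.card_prod, hT, Fintype.card_fun, Fintype.card_bool] at hcard
  calc _ ≤ _ := Nat.mul_le_mul_right _ hcard
    _ = _ := by rw [mul_assoc, ← pow_add, hK]

open Classical in
/-- If fewer bits enter a set of nodes than it has outputs, then erasing the inputs inside the set
causes an error with probability at least one half. -/
lemma half_mul_pow_le_blockErrorProb (D : FixedLengthComputation C n k) {p : ℝ} (hp : 0 ≤ p)
    (hp2 : p ≤ 1 / 2) (enc : Bits k → Bits n) (S : C.Node → Prop)
    (hlt : ∑ t with D.Enters S t, D.size t < (Finset.univ.filter fun j => S (D.outputNode j)).card) :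
    1 / 2 * (2 * p) ^ (Finset.univ.filter fun i => S (D.inputNode i)).card ≤
      blockErrorProb p enc D.run := by
  set I := Finset.univ.filter fun i => S (D.inputNode i) with hI
  let good : Bits k → ({i // i ∈ I} → Bool) → Prop := fun b z =>
    ∃ x : Bits n, (fun i : {i // i ∈ I} => x i) = z ∧ ∀ j, S (D.outputNode j) → D.run x j = b j
  have hgood : ∀ z, ((2 : ℝ) ^ k) / 2 ≤ ∑ b : Bits k, if ¬ good b z then (1 : ℝ) else 0 := by
    intro z
    have h1 := D.card_reachable_mul_le S I (by simp [hI]) z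
    have h2 : 2 * (Finset.univ.filter fun b => good b z).card ≤ 2 ^ k := by
      -- One missing bit suffices: at most half of all messages `b` are then compatible with `z`.
      have h3 : 2 ^ (∑ t with D.Enters S t, D.size t) * 2 ≤
          2 ^ (Finset.univ.filter fun j => S (D.outputNode j)).card := by
        rw [← pow_succ]; exact Nat.pow_le_pow_right (by norm_num) hlt
      have h4 : 0 < 2 ^ (∑ t with D.Enters S t, D.size t) := by positivity
      refine Nat.le_of_mul_le_mul_left ?_ h4
      calc _ = (Finset.univ.filter fun b => good b z).card *
              (2 ^ (∑ t with D.Enters S t, D.size t) * 2) := by ring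
        _ ≤ _ := Nat.mul_le_mul_left _ h3
        _ ≤ _ := h1
    have h5 := Finset.card_filter_add_card_filter_not (s := Finset.univ) (fun b => good b z)
    simp only [Finset.card_univ, Fintype.card_fun, Fintype.card_bool, Fintype.card_fin] at h5
    rw [Finset.sum_boole]
    have h2' : (2 : ℝ) * (Finset.univ.filter fun b => good b z).card ≤ 2 ^ k := by exact_mod_cast h2
    have h5' : ((Finset.univ.filter fun b => good b z).card : ℝ) +
      (Finset.univ.filter fun b => ¬ good b z).card = 2 ^ k := by exact_mod_cast h5
    linarith
  have hb : ∀ b : Bits k, p ^ I.card * (∑ z, if ¬ good b z then 1 else 0) ≤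
      ∑ y : Bits n, if D.run y ≠ b then bscProb p (enc b) y else 0 := fun b =>
    pow_mul_sum_le_sum_bscProb hp hp2 I (enc b) (fun y => D.run y ≠ b) (fun z => ¬ good b z)
      fun y hy hyb => hy ⟨y, rfl, fun j _ => congrFun hyb j⟩
  -- The `2 ^ I.card` patterns `z`, each of weight `p ^ I.card`, give the factor `(2 * p) ^ I.card`;
  -- each is wrong for at least half of the messages.
  calc 1 / 2 * (2 * p) ^ I.card
      = (1 / 2) ^ k * (p ^ I.card * ∑ _z : {i // i ∈ I} → Bool, (2 : ℝ) ^ k / 2) := by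
        simp only [Finset.sum_const, Finset.card_univ, Fintype.card_fun, Fintype.card_bool,
          Fintype.card_coe, nsmul_eq_mul, mul_pow, one_div, inv_pow]
        push_cast
        field_simp
    _ ≤ (1 / 2) ^ k * (p ^ I.card * ∑ z, ∑ b : Bits k, if ¬ good b z then (1 : ℝ) else 0) := by
        gcongr with z _
        exact hgood z
    _ = ∑ b : Bits k, (1 / 2 : ℝ) ^ k * (p ^ I.card * ∑ z, if ¬ good b z then (1 : ℝ) else 0) := by
        rw [Finset.sum_comm, Finset.mul_sum, Finset.mul_sum]
    _ ≤ _ := Finset.sum_le_sum fun b _ => mul_le_mul_of_nonneg_left (hb b) (by positivity)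

lemma bitMeters_eq_sum_messages (D : FixedLengthComputation C n k) :
    D.bitMeters = ∑ t, (D.size t : ℝ) *
      dist (C.src (D.link t) : Plane) (C.dst (D.link t) : Plane) := by
  classical
  unfold bitMeters linkBitMeters linkBits
  rw [← Finset.sum_fiberwise (s := Finset.univ) (g := D.link)]
  refine Finset.sum_congr rfl fun e _ => ?_
  push_cast
  rw [Finset.sum_mul]
  refine Finset.sum_congr (by congr) fun t ht => ?_
  rw [(Finset.mem_filter.mp ht).2]

open Classical in
/-- A family of node sets, each entered by at least as many bits as it has outputs, such that every
link enters few of them compared with its length. -/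
lemma sum_card_le_bitMeters (D : FixedLengthComputation C n k) {ι : Type*} (A : Finset ι)
    (S : ι → C.Node → Prop) (c : ℝ) (hc : 0 ≤ c)
    (hcut : ∀ i ∈ A, (Finset.univ.filter fun j => S i (D.outputNode j)).card ≤
      ∑ t with D.Enters (S i) t, D.size t)
    (hlink : ∀ u v : C.Node, c * (A.filter fun i => ¬ S i u ∧ S i v).card ≤
      dist (u : Plane) (v : Plane)) :
    c * ∑ j, ((A.filter fun i => S i (D.outputNode j)).card : ℝ) ≤ D.bitMeters := by
  -- Double counting: of outputs against sets, then of messages against the sets they enter.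
  have h1 : ∑ j, (A.filter fun i => S i (D.outputNode j)).card ≤
      ∑ t, D.size t * (A.filter fun i => D.Enters (S i) t).card := by
    calc ∑ j, (A.filter fun i => S i (D.outputNode j)).card
        = ∑ i ∈ A, (Finset.univ.filter fun j => S i (D.outputNode j)).card := by
          simp only [Finset.card_filter]
          exact Finset.sum_comm
      _ ≤ ∑ i ∈ A, ∑ t with D.Enters (S i) t, D.size t := Finset.sum_le_sum hcut
      _ = ∑ i ∈ A, ∑ t, if D.Enters (S i) t then D.size t else 0 := by
          simp only [Finset.sum_filter]
      _ = ∑ t, ∑ i ∈ A, if D.Enters (S i) t then D.size t else 0 := Finset.sum_comm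
      _ = ∑ t, D.size t * (A.filter fun i => D.Enters (S i) t).card := by
          refine Finset.sum_congr rfl fun t _ => ?_
          rw [← Finset.sum_filter, Finset.sum_const, smul_eq_mul, mul_comm]
  have h2 : ∑ j, ((A.filter fun i => S i (D.outputNode j)).card : ℝ) ≤
      ∑ t, (D.size t : ℝ) * (A.filter fun i => D.Enters (S i) t).card := by exact_mod_cast h1
  rw [bitMeters_eq_sum_messages]
  refine (mul_le_mul_of_nonneg_left h2 hc).trans ?_
  rw [Finset.mul_sum]
  refine Finset.sum_le_sum fun t _ => ?_
  have h3 : (A.filter fun i => D.Enters (S i) t) =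
      A.filter fun i => ¬ S i (C.src (D.link t)) ∧ S i (C.dst (D.link t)) :=
    Finset.filter_congr fun i _ => Iff.rfl
  rw [mul_left_comm, h3]
  exact mul_le_mul_of_nonneg_left (hlink _ _) (Nat.cast_nonneg _)

end FixedLengthComputation

/-! ### Lattice geometry: nested boxes and shifted tilings. -/

variable {M : ImplementationModel}

lemma Circuit.exists_latticeCoord (C : Circuit M) (v : C.Node) :
    ∃ w : ℤ × ℤ, (v : Plane) = !₂[w.1 * M.lam, w.2 * M.lam] := by
  obtain ⟨s, t, h⟩ := (C.nodes_subset v.2).1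
  exact ⟨(s, t), h⟩

/-- The integer coordinates of a node on the lattice. -/
noncomputable def Circuit.latticeCoord (C : Circuit M) (v : C.Node) : ℤ × ℤ :=
  (C.exists_latticeCoord v).choose

lemma Circuit.coe_eq_latticeCoord (C : Circuit M) (v : C.Node) :
    (v : Plane) = !₂[(C.latticeCoord v).1 * M.lam, (C.latticeCoord v).2 * M.lam] :=
  (C.exists_latticeCoord v).choose_spec

lemma Circuit.latticeCoord_injective (C : Circuit M) : Function.Injective C.latticeCoord := by
  intro u v h
  apply Subtype.ext
  rw [C.coe_eq_latticeCoord u, C.coe_eq_latticeCoord v, h]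

lemma Circuit.lam_mul_max_le_dist (C : Circuit M) (u v : C.Node) :
    M.lam * (max |(C.latticeCoord v).1 - (C.latticeCoord u).1|
      |(C.latticeCoord v).2 - (C.latticeCoord u).2| : ℤ) ≤ dist (u : Plane) (v : Plane) := by
  have hcoord : ∀ i, |(v : Plane) i - (u : Plane) i| ≤ dist (u : Plane) (v : Plane) := fun i => by
    rw [dist_comm, dist_eq_norm]
    simpa using PiLp.norm_apply_le ((v : Plane) - (u : Plane)) i
  have h0 := hcoord 0
  have h1 := hcoord 1
  have hl := M.lam_pos
  rw [C.coe_eq_latticeCoord u, C.coe_eq_latticeCoord v] at h0 h1 ⊢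
  simp only [Matrix.cons_val_zero, Matrix.cons_val_one, ← sub_mul, abs_mul,
    abs_of_pos hl] at h0 h1
  push_cast
  rw [mul_max_of_nonneg _ _ hl.le, max_le_iff]
  constructor <;> linarith

/-- Depth of the lattice point `w` inside the box of `a × a` lattice points with lower corner
`(X, Y)`; negative outside the box. -/
def boxDepth (a X Y : ℤ) (w : ℤ × ℤ) : ℤ :=
  min (min (w.1 - X) (X + a - 1 - w.1)) (min (w.2 - Y) (Y + a - 1 - w.2))

lemma le_boxDepth_iff {a X Y r : ℤ} {w : ℤ × ℤ} : r ≤ boxDepth a X Y w ↔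
    (X + r ≤ w.1 ∧ w.1 + r ≤ X + a - 1) ∧ (Y + r ≤ w.2 ∧ w.2 + r ≤ Y + a - 1) := by
  unfold boxDepth
  simp only [le_min_iff]
  omega

/-- Depth is a minimum of functions that are 1-Lipschitz in the sup norm. -/
lemma boxDepth_sub_le (a X Y : ℤ) (u v : ℤ × ℤ) :
    boxDepth a X Y v - boxDepth a X Y u ≤ max |v.1 - u.1| |v.2 - u.2| := by
  unfold boxDepth
  grind

lemma eq_ediv_of_mem_tile {a s x i : ℤ} (h1 : a * i - s ≤ x) (h2 : x ≤ a * i - s + a - 1) :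
    i = (x + s) / a := by
  have ha : 0 < a := by linarith
  refine ((Int.ediv_emod_unique (a := x + s) (r := x + s - a * i) (q := i) ha).2
    ⟨by ring, by linarith, by linarith⟩).1.symm

/-- A shift by half a period exchanges the middle half of a tile with its two outer quarters. -/
lemma exists_half_shift_mem_middle {q : ℤ} (hq : 0 < q) (x : ℤ) :
    ∃ ε : Fin 2, ∃ i : ℤ, 4 * q * i - 2 * q * (ε : ℕ) + q ≤ x ∧
      x + q ≤ 4 * q * i - 2 * q * (ε : ℕ) + 4 * q - 1 := by
  have h := Int.mul_ediv_add_emod x (4 * q)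
  have h0 := Int.emod_nonneg x (b := 4 * q) (by linarith)
  have h1 := Int.emod_lt_of_pos x (b := 4 * q) (by linarith)
  by_cases hlow : x % (4 * q) < q
  · exact ⟨1, x / (4 * q), by simp; linarith, by simp; linarith⟩
  by_cases hhigh : x % (4 * q) < 3 * q
  · exact ⟨0, x / (4 * q), by simp; linarith, by simp; linarith⟩
  · exact ⟨1, x / (4 * q) + 1, by simp; linarith, by simp; linarith⟩

/-- The nodes at depth at least `r` in the tile `i` of the tiling of the lattice by boxes of side
`a`, shifted by `-s`. -/
def Circuit.tile (C : Circuit M) (a : ℤ) (s : ℤ × ℤ) (i : (ℤ × ℤ) × ℕ) (v : C.Node) : Prop :=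
  (i.2 : ℤ) ≤ boxDepth a (a * i.1.1 - s.1) (a * i.1.2 - s.2) (C.latticeCoord v)

/-- The index of the tile that contains a node. -/
noncomputable def Circuit.tileIndex (C : Circuit M) (a : ℤ) (s : ℤ × ℤ) (v : C.Node) : ℤ × ℤ :=
  (((C.latticeCoord v).1 + s.1) / a, ((C.latticeCoord v).2 + s.2) / a)

lemma Circuit.eq_tileIndex_of_tile (C : Circuit M) {a : ℤ} {s : ℤ × ℤ} {i : (ℤ × ℤ) × ℕ}
    {v : C.Node} (h : C.tile a s i v) : i.1 = C.tileIndex a s v := by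
  obtain ⟨⟨h1, h2⟩, h3, h4⟩ := le_boxDepth_iff.1 h
  exact Prod.ext (eq_ediv_of_mem_tile (by linarith) (by linarith))
    (eq_ediv_of_mem_tile (by linarith) (by linarith))

/-- The tiles that contain nodes, with the depths `0, …, q - 1`. -/
noncomputable def Circuit.tileIndices (C : Circuit M) (a : ℤ) (s : ℤ × ℤ) (q : ℕ) :
    Finset ((ℤ × ℤ) × ℕ) :=
  (Finset.univ.image (C.tileIndex a s)) ×ˢ Finset.range q

-- Only boxes in the tile of `v` can be entered, and they are those whose depth index lies above the
-- depth of `u` and at most at that of `v`.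
open Classical in
lemma Circuit.lam_mul_card_tiles_le_dist (C : Circuit M) (a : ℤ) (s : ℤ × ℤ) (q : ℕ)
    (u v : C.Node) :
    M.lam * ((C.tileIndices a s q).filter fun i => ¬ C.tile a s i u ∧ C.tile a s i v).card ≤
      dist (u : Plane) (v : Plane) := by
  refine le_trans (mul_le_mul_of_nonneg_left ?_ M.lam_pos.le) (C.lam_mul_max_le_dist u v)
  set i₀ := C.tileIndex a s v
  set d := boxDepth a (a * i₀.1 - s.1) (a * i₀.2 - s.2)
  have hcard : ((C.tileIndices a s q).filter fun i => ¬ C.tile a s i u ∧ C.tile a s i v).card ≤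
      (Finset.Ioc (d (C.latticeCoord u)) (d (C.latticeCoord v))).card := by
    refine Finset.card_le_card_of_injOn (fun i => (i.2 : ℤ)) ?_ ?_
    · rintro ⟨i, r⟩ hi
      obtain ⟨-, hu, hv⟩ := Finset.mem_filter.1 hi
      obtain rfl : i = i₀ := C.eq_tileIndex_of_tile hv
      simpa using ⟨not_le.1 hu, hv⟩
    · rintro ⟨i, r⟩ hi ⟨i', r'⟩ hi' hr
      have h1 := C.eq_tileIndex_of_tile (Finset.mem_filter.1 hi).2.2
      have h2 := C.eq_tileIndex_of_tile (Finset.mem_filter.1 hi').2.2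
      exact Prod.ext (h1.trans h2.symm) (Nat.cast_injective hr)
  rw [Int.card_Ioc] at hcard
  have hd := boxDepth_sub_le a (a * i₀.1 - s.1) (a * i₀.2 - s.2) (C.latticeCoord u)
    (C.latticeCoord v)
  -- The cardinality of `Ioc` is a truncated difference; this covers the case where `v` is less deep
  -- than `u`.
  have h0 : (0 : ℤ) ≤ max |(C.latticeCoord v).1 - (C.latticeCoord u).1|
      |(C.latticeCoord v).2 - (C.latticeCoord u).2| := le_max_of_le_left (abs_nonneg _)
  have : (((C.tileIndices a s q).filter fun i => ¬ C.tile a s i u ∧ C.tile a s i v).card : ℤ) ≤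
      max |(C.latticeCoord v).1 - (C.latticeCoord u).1|
      |(C.latticeCoord v).2 - (C.latticeCoord u).2| := by
    change d _ - d _ ≤ _ at hd
    omega
  exact_mod_cast this

-- Distinct inputs occupy distinct lattice points, and an `a × a` box has `a ^ 2` of them.
open Classical in
lemma FixedLengthComputation.card_inputs_tile_le {C : Circuit M} {n k : ℕ}
    (D : FixedLengthComputation C n k) (a : ℕ) (s : ℤ × ℤ) (i : (ℤ × ℤ) × ℕ) :
    (Finset.univ.filter fun j => C.tile a s i (D.inputNode j)).card ≤ a ^ 2 := by
  set X := a * i.1.1 - s.1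
  set Y := a * i.1.2 - s.2
  have h : (Finset.univ.filter fun j => C.tile a s i (D.inputNode j)).card ≤
      (Finset.Ico X (X + a) ×ˢ Finset.Ico Y (Y + a)).card := by
    refine Finset.card_le_card_of_injOn (fun j => C.latticeCoord (D.inputNode j)) ?_ ?_
    · intro j hj
      obtain ⟨⟨h1, h2⟩, h3, h4⟩ := le_boxDepth_iff.1 (Finset.mem_filter.1 hj).2
      simp only [Finset.coe_product, Finset.coe_Ico, Set.mem_prod, Set.mem_Ico]
      refine ⟨⟨?_, ?_⟩, ?_, ?_⟩ <;> omega
    · exact (C.latticeCoord_injective.comp D.inputNode.injective).injOn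
  rw [Finset.card_product, Int.card_Ico, Int.card_Ico] at h
  simpa [sq] using h

open Classical in
lemma Circuit.exists_shift_le_card_tiles (C : Circuit M) {q : ℕ} (hq : 0 < q) (v : C.Node) :
    ∃ ε : Fin 2 × Fin 2, q ≤ ((C.tileIndices (4 * q) (2 * q * (ε.1 : ℕ), 2 * q * (ε.2 : ℕ)) q).filter
      fun i => C.tile (4 * q) (2 * q * (ε.1 : ℕ), 2 * q * (ε.2 : ℕ)) i v).card := by
  have hq' : (0 : ℤ) < q := by exact_mod_cast hq
  obtain ⟨ε₁, i₁, h1, h2⟩ := exists_half_shift_mem_middle hq' (C.latticeCoord v).1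
  obtain ⟨ε₂, i₂, h3, h4⟩ := exists_half_shift_mem_middle hq' (C.latticeCoord v).2
  refine ⟨(ε₁, ε₂), ?_⟩
  have htile : ∀ r < q, C.tile (4 * q) (2 * q * (ε₁ : ℕ), 2 * q * (ε₂ : ℕ)) ((i₁, i₂), r) v := by
    intro r hr
    have hr' : (r : ℤ) < q := by exact_mod_cast hr
    refine le_boxDepth_iff.2 ⟨⟨?_, ?_⟩, ?_, ?_⟩ <;> simp only <;> linarith
  calc q = (Finset.range q).card := (Finset.card_range q).symm
    _ ≤ _ := by
      refine Finset.card_le_card_of_injOn (fun r => ((i₁, i₂), r)) ?_ ?_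
      · intro r hr
        have hr' := Finset.mem_range.1 hr
        refine Finset.mem_filter.2 ⟨Finset.mem_product.2 ⟨?_, hr⟩, htile r hr'⟩
        exact Finset.mem_image.2 ⟨v, Finset.mem_univ _, (C.eq_tileIndex_of_tile (htile r hr')).symm⟩
      · intro r _ r' _ h
        exact (Prod.ext_iff.1 h).2

/-- If erasing any `(4 q)²` inputs is more likely than a block error by a factor above two, then
every output costs `q λ / 4` bit-meters. -/
lemma FixedLengthComputation.mul_le_four_mul_bitMeters {C : Circuit M} {n k : ℕ}
    (D : FixedLengthComputation C n k) {p : ℝ} (hp : 0 < p) (hp2 : p ≤ 1 / 2)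
    (enc : Bits k → Bits n) {q : ℕ} (hq : 0 < q)
    (herr : blockErrorProb p enc D.run < 1 / 2 * (2 * p) ^ ((4 * q) ^ 2)) :
    k * q * M.lam ≤ 4 * D.bitMeters := by
  classical
  let shift : Fin 2 × Fin 2 → ℤ × ℤ := fun ε => (2 * q * (ε.1 : ℕ), 2 * q * (ε.2 : ℕ))
  let N : Fin 2 × Fin 2 → Fin k → ℕ := fun ε j => ((C.tileIndices (4 * q) (shift ε) q).filter
      fun i => C.tile (4 * q) (shift ε) i (D.outputNode j)).card
  have hN : ∀ ε, M.lam * ∑ j, (N ε j : ℝ) ≤ D.bitMeters := by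
    intro ε
    refine D.sum_card_le_bitMeters _ _ _ M.lam_pos.le (fun i _ => ?_)
      (C.lam_mul_card_tiles_le_dist _ _ q)
    by_contra hlt
    have h1 := D.half_mul_pow_le_blockErrorProb hp.le hp2 enc _ (not_le.1 hlt)
    have h2 := D.card_inputs_tile_le (4 * q) (shift ε) i
    push_cast at h2
    have h3 : (2 * p) ^ ((4 * q) ^ 2) ≤ (2 * p) ^
        (Finset.univ.filter fun j => C.tile (4 * q) (shift ε) i (D.inputNode j)).card :=
      pow_le_pow_of_le_one (by linarith) (by linarith) h2
    linarith
  have hq_le : ∀ j, (q : ℝ) ≤ ∑ ε, (N ε j : ℝ) := by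
    intro j
    obtain ⟨ε, hε⟩ := C.exists_shift_le_card_tiles hq (D.outputNode j)
    calc (q : ℝ) ≤ N ε j := by exact_mod_cast hε
      _ ≤ _ := Finset.single_le_sum (f := fun ε => (N ε j : ℝ))
        (fun _ _ => Nat.cast_nonneg _) (Finset.mem_univ ε)
  calc k * q * M.lam = M.lam * ∑ _j : Fin k, (q : ℝ) := by simp; ring
    _ ≤ M.lam * ∑ j, ∑ ε, (N ε j : ℝ) :=
        mul_le_mul_of_nonneg_left (Finset.sum_le_sum fun j _ => hq_le j) M.lam_pos.le
    _ = ∑ ε, M.lam * ∑ j, (N ε j : ℝ) := by rw [Finset.sum_comm, Finset.mul_sum]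
    _ ≤ ∑ _ε : Fin 2 × Fin 2, D.bitMeters := Finset.sum_le_sum fun ε _ => hN ε
    _ = 4 * D.bitMeters := by simp

end InfoFriction

/-! ### Choice of the box size. -/

theorem theorem1 (H : InfoFriction.ChannelModel) (M : InfoFriction.ImplementationModel)
    (PT : ℝ) (hPT : 0 < PT) (n k : ℕ)
    (enc : InfoFriction.Bits k → InfoFriction.Bits n)
    (C : InfoFriction.Circuit M) (DecCkt : InfoFriction.FixedLengthComputation C n k)
    (Pe : ℝ) (hPe : InfoFriction.blockErrorProb (H.pch PT) enc DecCkt.run = Pe)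
    (hcond : Real.log (1 / (10 * Pe)) > 50 * Real.log (1 / (2 * H.pch PT))) :
    DecCkt.bitMeters ≥
      k / (48 * Real.sqrt 2) *
        Real.sqrt (Real.log (1 / (10 * Pe)) / Real.log (1 / (2 * H.pch PT))) * M.lam := by
  have hp := H.pch_pos PT
  have hp2 := H.pch_lt_half hPT
  set p := H.pch PT
  have hlam := M.lam_pos
  have hPe0 : 0 ≤ Pe := hPe ▸ InfoFriction.blockErrorProb_nonneg hp.le (by linarith) enc DecCkt.run
  have hlogp : 0 < Real.log (1 / (2 * p)) := by
    apply Real.log_pos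
    rw [lt_div_iff₀ (by linarith)]
    linarith
  have hPe_pos : 0 < Pe := by
    -- At `Pe = 0` the conventions `1 / 0 = 0` and `log 0 = 0` make `hcond` false.
    refine lt_of_le_of_ne hPe0 fun h => ?_
    rw [← h] at hcond
    norm_num at hcond hlogp
    linarith
  set R := Real.log (1 / (10 * Pe)) / Real.log (1 / (2 * p)) with hR
  have hR50 : 50 < R := by
    rw [hR, lt_div_iff₀ hlogp]
    exact hcond
  have hsqrt : 4 ≤ Real.sqrt R := Real.le_sqrt_of_sq_le (by linarith)
  -- The largest `q` with `(4 * q) ^ 2 ≤ R`, which is what makes erasing a whole box likelier than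
  -- the allowed error.
  set q := ⌊Real.sqrt R / 4⌋₊
  have hq1 : 1 ≤ q := Nat.le_floor (by push_cast; linarith)
  have hq1' : (1 : ℝ) ≤ q := by exact_mod_cast hq1
  have hq_le : 4 * (q : ℝ) ≤ Real.sqrt R := by
    have := Nat.floor_le (a := Real.sqrt R / 4) (by positivity)
    linarith
  -- Rounding loses at most a factor of two, since `q + 1 ≤ 2 * q`.
  have hsqrt_le : Real.sqrt R ≤ 8 * q := by
    have := Nat.lt_floor_add_one (Real.sqrt R / 4)
    linarith
  have hm : (((4 * q) ^ 2 : ℕ) : ℝ) ≤ R := by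
    push_cast
    calc (4 * (q : ℝ)) ^ 2 ≤ Real.sqrt R ^ 2 := by gcongr
      _ = R := Real.sq_sqrt (by linarith)
  have hpow : 10 * Pe ≤ (2 * p) ^ ((4 * q) ^ 2) := by
    rw [hR, le_div_iff₀ hlogp, one_div, one_div, Real.log_inv, Real.log_inv] at hm
    rw [← Real.log_le_log_iff (by linarith) (by positivity), Real.log_pow]
    linarith
  have hmain := DecCkt.mul_le_four_mul_bitMeters hp hp2.le enc hq1 (by rw [hPe]; linarith)
  have h2 : 1 ≤ Real.sqrt 2 := Real.one_le_sqrt.2 (by norm_num)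
  -- The argument gives the constant 32 = 4 · 8, from four shifts and `√R ≤ 8 * q`; this is stronger
  -- than needed.
  have hk : (k : ℝ) / (48 * Real.sqrt 2) ≤ k / 32 :=
    div_le_div_of_nonneg_left (Nat.cast_nonneg k) (by norm_num) (by linarith)
  calc (k : ℝ) / (48 * Real.sqrt 2) * Real.sqrt R * M.lam ≤ k / 32 * (8 * q) * M.lam := by gcongr
    _ = k * q * M.lam / 4 := by ring
    _ ≤ DecCkt.bitMeters := by linarith
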